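/- Let $G$ be a finite simple bipartite graph whose vertex set is the disjoint union of two classes $A$ and $B$, with $\#A=n$ and $\#B=m$, every edge joining a vertex of $A$ to a vertex of $B$; let $e$ be its number of edges. A trail of length $s$ from $v_0$ to $v_s$ in $G$ is a sequence $(v_0,\dots,v_s)$ of vertices such that $\{v_0,v_1\},\dots,\{v_{s-1},v_s\}$ are pairwise distinct edges of $G$. Let $s\ge 1$ and $c\ge 0$ be integers. Suppose that for no vertex $v_0\in A$ and no vertex $v_s$ (possibly equal to $v_0$) does $G$ contain $c$ pairwise distinct trails of length $s$ from $v_0$ to $v_s$. Then $$ e\le 4\,\max\bigl((4c)^{1/(2s)},\,9\pi s/4\bigr)^2\,\min(m,n)^{1/s}\,\max(m,n). $$ -/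

import Mathlib

/-! Let M be the maximum in the bound, μ = min(m, n) and D = 2M²μ^(1/s), and suppose e > 2D max(m,
n). Weights e/(2n) on A and e/(2m) on B sum to e, so deleting vertices of too small degree leaves a
nonempty S where each degree is at least the weight, hence at least D. From v₀ in A ∩ S grow trails
greedily in S: after i steps at most i edges are forbidden. As D ≥ 2s², Bernoulli's inequality
bounds the total loss by a factor 2. The last degree bound carries an extra factor |K|/μ, where K is
the class holding the far ends, and D^s ≥ 2cμ, so there are at least c|K| trails. By pigeonhole c of
them share both ends (`card_lt_of_avoids`). -/

/-- If the total weight of the vertices is at most the number of edges, then some nonempty vertex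
set induces a subgraph in which every degree is at least the weight of the vertex. -/
theorem exists_nonempty_weight_le_degree {V : Type*} [Fintype V] [DecidableEq V] [Nonempty V]
    (G : SimpleGraph V) [DecidableRel G.Adj] (t : V → ℝ)
    (ht : ∑ v, t v ≤ (G.edgeFinset.card : ℝ)) :
    ∃ S : Finset V, S.Nonempty ∧ ∀ v ∈ S, t v ≤ ((S.filter (G.Adj v)).card : ℝ) := by
  -- Adjacent ordered pairs in `S`: twice the number of induced edges.
  set q : Finset V → ℝ := fun S => ∑ u ∈ S, ∑ w ∈ S, if G.Adj u w then (1 : ℝ) else 0 with hq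
  have hdeg : ∀ (S : Finset V) (v : V),
      ((S.filter (G.Adj v)).card : ℝ) = ∑ w ∈ S, if G.Adj v w then (1 : ℝ) else 0 := by
    intro S v
    simp
  have hins : ∀ (S : Finset V) (v : V), v ∉ S →
      q (insert v S) = q S + 2 * (((insert v S).filter (G.Adj v)).card : ℝ) := by
    intro S v hv
    have hsymm : ∑ u ∈ S, (if G.Adj u v then (1 : ℝ) else 0) =
        ∑ u ∈ S, if G.Adj v u then (1 : ℝ) else 0 :=
      Finset.sum_congr rfl fun u _ => by simp only [G.adj_comm u v]
    rw [hdeg, hq]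
    simp only [Finset.sum_insert hv, Finset.sum_add_distrib, hsymm, G.irrefl, if_false]
    ring
  have huniv : q Finset.univ = 2 * (G.edgeFinset.card : ℝ) := by
    have h := G.sum_degrees_eq_twice_card_edges
    have h' : (∑ v, (G.degree v : ℝ)) = 2 * (G.edgeFinset.card : ℝ) := by exact_mod_cast h
    rw [← h', hq]
    refine Finset.sum_congr rfl fun v _ => ?_
    rw [← hdeg, ← G.card_neighborFinset_eq_degree, G.neighborFinset_eq_filter]
  obtain ⟨S, hS, hmin⟩ := Finset.exists_min_image
    (Finset.univ.filter fun S : Finset V => S.Nonempty ∧ 2 * ∑ v ∈ S, t v ≤ q S) Finset.card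
    ⟨Finset.univ, by
      simp only [Finset.mem_filter, Finset.mem_univ, true_and]
      exact ⟨Finset.univ_nonempty, by rw [huniv]; linarith⟩⟩
  simp only [Finset.mem_filter, Finset.mem_univ, true_and] at hS hmin
  refine ⟨S, hS.1, fun v hv => ?_⟩
  by_contra! hlt
  -- Deleting `v` makes the inequality strict, so the remaining set is nonempty (both sides vanish
  -- on `∅`), against minimality.
  have hv' : v ∉ S.erase v := Finset.notMem_erase v S
  have h1 := hins (S.erase v) v hv'
  rw [Finset.insert_erase hv] at h1
  have h2 : ∑ u ∈ S.erase v, t u + t v = ∑ u ∈ S, t u := Finset.sum_erase_add S t hv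
  have h3 : 2 * ∑ u ∈ S.erase v, t u < q (S.erase v) := by linarith [hS.2]
  have hne : (S.erase v).Nonempty := by
    by_contra hempty
    rw [Finset.not_nonempty_iff_eq_empty] at hempty
    simp [hempty, hq] at h3
  have h4 := hmin _ ⟨hne, h3.le⟩
  have h5 := Finset.card_erase_lt_of_mem hv
  omega

/-- Greedy count of trails ending at `v₀`: if adjacency leads from each class `K i` into
`K (i + 1)`, and every vertex of `S` in `K i` has at least `x i` neighbours in `S`, then at least
`∏ (x i - i)` trails of length `k` start in `S` and end at `v₀`. -/
theorem exists_finset_isTrail {V : Type*} [Fintype V] [DecidableEq V]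
    (G : SimpleGraph V) [DecidableRel G.Adj] (S : Finset V) (K : ℕ → Finset V) (x : ℕ → ℝ)
    (hK : ∀ i, ∀ v ∈ K i, ∀ w, G.Adj v w → w ∈ K (i + 1))
    (hx : ∀ i, ∀ v ∈ S, v ∈ K i → x i ≤ ((S.filter (G.Adj v)).card : ℝ))
    (v₀ : V) (hv₀ : v₀ ∈ S) (hv₀K : v₀ ∈ K 0) (k : ℕ) (hpos : ∀ i < k, (i : ℝ) ≤ x i) :
    ∃ T : Finset (Σ v, G.Walk v v₀),
      (∀ p ∈ T, p.2.IsTrail ∧ p.2.length = k ∧ p.1 ∈ S ∧ p.1 ∈ K k) ∧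
      ∏ i ∈ Finset.range k, (x i - i) ≤ (T.card : ℝ) := by
  induction k with
  | zero => exact ⟨{⟨v₀, .nil⟩}, by simp [hv₀, hv₀K], by simp⟩
  | succ k ih =>
    obtain ⟨T, hT, hcard⟩ := ih fun i hi => hpos i (by omega)
    let F : (Σ v, G.Walk v v₀) → Finset V := fun p =>
      (S.filter (G.Adj p.1)).filter fun w => s(w, p.1) ∉ p.2.edges
    -- The `else` value is junk: `g` is only used on `T.sigma F`, where adjacency holds.
    let g : (Σ _ : (Σ v, G.Walk v v₀), V) → (Σ v, G.Walk v v₀) := fun y =>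
      if h : G.Adj y.2 y.1.1 then ⟨y.2, .cons h y.1.2⟩ else y.1
    have hF : ∀ p ∈ T, x k - k ≤ ((F p).card : ℝ) := by
      intro p hp
      obtain ⟨-, hlen, hpS, hpK⟩ := hT p hp
      have hbad : ((S.filter (G.Adj p.1)).filter fun w => ¬ s(w, p.1) ∉ p.2.edges).card ≤ k := by
        have hcardE : p.2.edges.toFinset.card ≤ k := by
          refine (List.toFinset_card_le _).trans ?_
          rw [SimpleGraph.Walk.length_edges, hlen]
        refine le_trans (Finset.card_le_card_of_injOn (fun w => s(w, p.1)) ?_ ?_) hcardE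
        · intro w hw
          simpa using (Finset.mem_filter.1 hw).2
        · intro w _ w' _ h
          exact Sym2.congr_left.1 h
      have hsum := Finset.card_filter_add_card_filter_not (s := S.filter (G.Adj p.1))
        (fun w => s(w, p.1) ∉ p.2.edges)
      have hxk := hx k p.1 hpS hpK
      have hle : (S.filter (G.Adj p.1)).card ≤ (F p).card + k := by
        simp only [F]; omega
      have : ((S.filter (G.Adj p.1)).card : ℝ) ≤ (F p).card + k := by exact_mod_cast hle
      linarith
    have hg : ∀ y ∈ T.sigma F, ∃ h : G.Adj y.2 y.1.1, g y = ⟨y.2, .cons h y.1.2⟩ := by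
      intro y hy
      have hadj : G.Adj y.2 y.1.1 := by
        have := (Finset.mem_sigma.1 hy).2
        simp only [F, Finset.mem_filter] at this
        exact this.1.2.symm
      exact ⟨hadj, by simp only [g, dif_pos hadj]⟩
    refine ⟨(T.sigma F).image g, ?_, ?_⟩
    · intro p hp
      obtain ⟨y, hy, rfl⟩ := Finset.mem_image.1 hp
      obtain ⟨hadj, hgy⟩ := hg y hy
      obtain ⟨hyT, hyF⟩ := Finset.mem_sigma.1 hy
      obtain ⟨htr, hlen, hpS, hpK⟩ := hT _ hyT
      simp only [F, Finset.mem_filter] at hyF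
      rw [hgy]
      exact ⟨(SimpleGraph.Walk.isTrail_cons _ _).2 ⟨htr, hyF.2⟩, by simp [hlen], hyF.1.1,
        hK k _ hpK _ hadj.symm⟩
    · have hinj : Set.InjOn g (T.sigma F : Set (Σ _ : (Σ v, G.Walk v v₀), V)) := by
        intro y hy z hz hyz
        obtain ⟨h, hgy⟩ := hg y hy
        obtain ⟨h', hgz⟩ := hg z hz
        rw [hgy, hgz] at hyz
        obtain ⟨⟨a, p⟩, w⟩ := y
        obtain ⟨⟨b, q⟩, w'⟩ := z
        simp only [Sigma.mk.injEq] at hyz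
        obtain ⟨rfl, hyz⟩ := hyz
        have hyz := eq_of_heq hyz
        simp only [SimpleGraph.Walk.cons.injEq] at hyz
        obtain ⟨rfl, hyz⟩ := hyz
        cases hyz
        rfl
      rw [Finset.card_image_of_injOn hinj, Finset.card_sigma, Finset.prod_range_succ]
      push_cast
      calc _ ≤ (T.card : ℝ) * (x k - k) :=
            mul_le_mul_of_nonneg_right hcard (sub_nonneg.2 (hpos k (by omega)))
        _ = ∑ _p ∈ T, (x k - k) := by rw [Finset.sum_const, nsmul_eq_mul]
        _ ≤ _ := Finset.sum_le_sum hF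

/-- Lower bound for the greedy trail count when one factor is larger by a ratio `r`. -/
theorem le_prod_range_sub {D r C : ℝ} {x : ℕ → ℝ} {k : ℕ}
    (hD : 2 * ((k : ℝ) + 1) ^ 2 ≤ D) (hr : 1 ≤ r) (hC : 2 * C ≤ D ^ (k + 1))
    (hx : ∀ i, D ≤ x i) (hxk : D * r ≤ x k) :
    C * r ≤ ∏ i ∈ Finset.range (k + 1), (x i - i) := by
  have hk : (0 : ℝ) ≤ k := Nat.cast_nonneg k
  have hDk : (k : ℝ) + 1 ≤ D := by nlinarith
  have hD0 : 0 < D := by linarith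
  have hbase : 0 ≤ D - (k + 1) := by linarith
  have hpow : D ^ (k + 1) / 2 ≤ (D - (k + 1)) ^ (k + 1) := by
    have hq : ((k : ℝ) + 1) * (((k : ℝ) + 1) / D) ≤ 1 / 2 := by
      rw [← mul_div_assoc, div_le_iff₀ hD0]
      nlinarith
    have hq1 : ((k : ℝ) + 1) / D ≤ 1 := (div_le_one hD0).2 hDk
    -- Bernoulli: (1 - (k+1)/D)^(k+1) ≥ 1 - (k+1)²/D ≥ 1/2.
    have hb := one_add_mul_le_pow (a := -(((k : ℝ) + 1) / D)) (by linarith) (k + 1)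
    push_cast at hb
    have hfac : D - (k + 1) = D * (1 + -(((k : ℝ) + 1) / D)) := by field_simp; ring
    rw [hfac, mul_pow]
    have hDp : 0 < D ^ (k + 1) := pow_pos hD0 _
    have : 1 / 2 ≤ (1 + -(((k : ℝ) + 1) / D)) ^ (k + 1) := by linarith
    nlinarith
  have hprod : (D - (k + 1)) ^ k ≤ ∏ i ∈ Finset.range k, (x i - i) := by
    have h := Finset.prod_le_prod (s := Finset.range k) (f := fun _ => D - (k + 1))
      (g := fun i => x i - i) (fun _ _ => hbase) fun i hi => by
        have hi' : (i : ℝ) ≤ k := by exact_mod_cast (Finset.mem_range.1 hi).le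
        linarith [hx i]
    simpa using h
  have hlast : (D - (k + 1)) * r ≤ x k - k := by nlinarith
  rw [Finset.prod_range_succ]
  calc C * r ≤ (D - (k + 1)) ^ (k + 1) * r :=
        mul_le_mul_of_nonneg_right (by linarith) (by linarith)
    _ = (D - (k + 1)) ^ k * ((D - (k + 1)) * r) := by ring
    _ ≤ _ := mul_le_mul hprod hlast (mul_nonneg hbase (by linarith))
        ((pow_nonneg hbase k).trans hprod)

/-- The quantity `2 M² μ^(1/s)`, with `M` the maximum in the main bound, is at least `2 s²`, and
its `s`-th power is at least `2 c μ`. -/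
theorem two_mul_max_sq_mul_rpow_bounds {s c : ℕ} (hs : 1 ≤ s) {μ : ℝ} (hμ : 1 ≤ μ) :
    2 * (s : ℝ) ^ 2 ≤ 2 * (max ((4 * (c : ℝ)) ^ (1 / (2 * (s : ℝ))))
        (9 * Real.pi * (s : ℝ) / 4)) ^ 2 * μ ^ (1 / (s : ℝ)) ∧
      2 * (c * μ) ≤ (2 * (max ((4 * (c : ℝ)) ^ (1 / (2 * (s : ℝ))))
        (9 * Real.pi * (s : ℝ) / 4)) ^ 2 * μ ^ (1 / (s : ℝ))) ^ s := by
  set M := max ((4 * (c : ℝ)) ^ (1 / (2 * (s : ℝ)))) (9 * Real.pi * (s : ℝ) / 4) with hM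
  have hs' : (1 : ℝ) ≤ s := by exact_mod_cast hs
  have hs0 : (s : ℝ) ≠ 0 := by positivity
  have hc0 : (0 : ℝ) ≤ 4 * c := by positivity
  have hMs : (s : ℝ) ≤ M := by
    refine le_trans ?_ (le_max_right _ _)
    nlinarith [Real.pi_gt_three]
  have hroot : 1 ≤ μ ^ (1 / (s : ℝ)) := Real.one_le_rpow hμ (by positivity)
  have hMpow : 4 * (c : ℝ) ≤ M ^ (2 * s) := by
    have h := pow_le_pow_left₀ (Real.rpow_nonneg hc0 _) (le_max_left _ _ : _ ≤ M) (2 * s)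
    rwa [← Real.rpow_natCast, ← Real.rpow_mul hc0, Nat.cast_mul, Nat.cast_ofNat,
      one_div_mul_cancel (by positivity), Real.rpow_one] at h
  have hμpow : (μ ^ (1 / (s : ℝ))) ^ s = μ := by
    rw [← Real.rpow_natCast, ← Real.rpow_mul (by linarith), one_div_mul_cancel hs0,
      Real.rpow_one]
  constructor
  · have : (s : ℝ) ^ 2 ≤ M ^ 2 := pow_le_pow_left₀ (by linarith) hMs 2
    nlinarith
  · rw [mul_pow, mul_pow, hμpow, ← pow_mul]
    have h2 : (1 : ℝ) ≤ 2 ^ s := one_le_pow₀ (by norm_num)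
    have h3 : 4 * (c : ℝ) ≤ 2 ^ s * M ^ (2 * s) := by nlinarith
    nlinarith [mul_nonneg (Nat.cast_nonneg (α := ℝ) c) (by linarith : (0 : ℝ) ≤ μ)]

/-- If no `c` distinct trails of length `s` join `v₀` to a common vertex, then fewer than
`c * #E` trails of length `s` end at `v₀` and start in `E`. -/
theorem card_lt_of_avoids {V : Type*} [Fintype V] [DecidableEq V] (G : SimpleGraph V)
    (E : Finset V) (hE : E.Nonempty) (s c : ℕ) (v₀ : V)
    (havoid : ∀ vₛ : V,
      ¬ ∃ T : Finset (G.Walk v₀ vₛ), T.card = c ∧ ∀ p ∈ T, p.IsTrail ∧ p.length = s)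
    (T : Finset (Σ v, G.Walk v v₀))
    (hT : ∀ p ∈ T, p.2.IsTrail ∧ p.2.length = s ∧ p.1 ∈ E) :
    T.card < c * E.card := by
  classical
  have hfib : ∀ v ∈ E, (T.filter fun p => p.1 = v).card < c := by
    intro v _
    by_contra! hc
    obtain ⟨U, hUT, hUc⟩ := Finset.exists_subset_card_eq hc
    have hU : ∀ p ∈ U, p ∈ T ∧ p.1 = v := fun p hp => Finset.mem_filter.1 (hUT hp)
    -- Trails were grown by `cons` at their start, so reversal makes them begin at `v₀`.
    refine havoid v ⟨U.attach.image fun p => (p.1.2.copy (hU _ p.2).2 rfl).reverse, ?_, ?_⟩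
    · rw [Finset.card_image_of_injective, Finset.card_attach, hUc]
      rintro ⟨⟨a, p⟩, hp⟩ ⟨⟨b, q⟩, hq⟩ h
      obtain rfl : a = v := (hU _ hp).2
      obtain rfl : b = a := (hU _ hq).2
      simpa using SimpleGraph.Walk.reverse_injective h
    · intro w hw
      obtain ⟨⟨⟨a, p⟩, hp⟩, -, rfl⟩ := Finset.mem_image.1 hw
      obtain rfl : a = v := (hU _ hp).2
      have := hT _ (hU _ hp).1
      simpa using ⟨this.1, this.2.1⟩
  rw [Finset.card_eq_sum_card_fiberwise (f := fun p => p.1) (t := E) fun p hp => (hT p hp).2.2]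
  calc _ < ∑ _v ∈ E, c := Finset.sum_lt_sum_of_nonempty hE hfib
    _ = c * E.card := by simp [mul_comm]

theorem mainTheorem6 {V : Type*} [Fintype V] [DecidableEq V]
    (G : SimpleGraph V) [DecidableRel G.Adj] (A B : Finset V)
    (hG : G.IsBipartiteWith (A : Set V) (B : Set V)) (hAB : A ∪ B = Finset.univ)
    (n m : ℕ) (hn : A.card = n) (hm : B.card = m)
    (s c : ℕ) (hs : 1 ≤ s)
    (hG_avoids : ∀ v₀ ∈ A, ∀ vₛ : V,
      ¬ ∃ T : Finset (G.Walk v₀ vₛ), T.card = c ∧ ∀ p ∈ T, p.IsTrail ∧ p.length = s) :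
    (G.edgeFinset.card : ℝ) ≤
      4 * (max ((4 * (c : ℝ)) ^ (1 / (2 * (s : ℝ)))) (9 * Real.pi * (s : ℝ) / 4)) ^ 2
        * (min (m : ℝ) (n : ℝ)) ^ (1 / (s : ℝ)) * max (m : ℝ) (n : ℝ) := by
  by_contra! hlt
  set D : ℝ := 2 * (max ((4 * (c : ℝ)) ^ (1 / (2 * (s : ℝ)))) (9 * Real.pi * (s : ℝ) / 4)) ^ 2
    * (min (m : ℝ) (n : ℝ)) ^ (1 / (s : ℝ)) with hDdef
  set e : ℝ := (G.edgeFinset.card : ℝ) with he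
  have hmin0 : (0 : ℝ) ≤ min (m : ℝ) n := le_min (Nat.cast_nonneg _) (Nat.cast_nonneg _)
  have hlt' : 2 * D * max (m : ℝ) n < e := by rw [hDdef]; linarith
  have he0 : 0 < e := by
    refine lt_of_le_of_lt ?_ hlt
    have : (0 : ℝ) ≤ max (m : ℝ) n := le_max_of_le_left (Nat.cast_nonneg _)
    have := Real.rpow_nonneg hmin0 (1 / (s : ℝ))
    positivity
  have hdisj : Disjoint A B := Finset.disjoint_coe.1 hG.disjoint
  have hAadj : ∀ v ∈ A, ∀ w, G.Adj v w → w ∈ B := fun v hv w h =>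
    Finset.mem_coe.1 (hG.mem_of_mem_adj (Finset.mem_coe.2 hv) h)
  have hBadj : ∀ v ∈ B, ∀ w, G.Adj v w → w ∈ A := fun v hv w h =>
    Finset.mem_coe.1 (hG.symm.mem_of_mem_adj (Finset.mem_coe.2 hv) h)
  have hmem : ∀ v, v ∈ A ∨ v ∈ B := fun v => Finset.mem_union.1 (hAB ▸ Finset.mem_univ v)
  obtain ⟨hA, hB⟩ : A.Nonempty ∧ B.Nonempty := by
    have hpos : 0 < G.edgeFinset.card := by rwa [he, Nat.cast_pos] at he0
    obtain ⟨ed, hed⟩ := Finset.card_pos.1 hpos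
    induction ed with
    | _ u w =>
      have hadj : G.Adj u w := by simpa using hed
      rcases hmem u with hu | hu
      · exact ⟨⟨u, hu⟩, ⟨w, hAadj u hu w hadj⟩⟩
      · exact ⟨⟨w, hBadj u hu w hadj⟩, ⟨u, hu⟩⟩
  have hn1 : (1 : ℝ) ≤ n := by exact_mod_cast hn ▸ hA.card_pos
  have hm1 : (1 : ℝ) ≤ m := by exact_mod_cast hm ▸ hB.card_pos
  obtain ⟨hD2, hDpow⟩ := two_mul_max_sq_mul_rpow_bounds (c := c) hs (le_min hm1 hn1)
  rw [← hDdef] at hD2 hDpow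
  have : Nonempty V := ⟨hA.choose⟩
  obtain ⟨S, hS, hSdeg⟩ := exists_nonempty_weight_le_degree G
    (fun v => if v ∈ A then e / (2 * n) else e / (2 * m)) (by
      rw [← hAB, Finset.sum_union hdisj, Finset.sum_congr rfl fun v hv => if_pos hv,
        Finset.sum_congr rfl fun v hv => if_neg (Finset.disjoint_right.1 hdisj hv)]
      simp only [Finset.sum_const, nsmul_eq_mul, hn, hm]
      apply le_of_eq
      rw [← he]
      field_simp
      norm_num)
  -- The class reached after `i` steps from a vertex of `A`.
  let K : ℕ → Finset V := fun i => if Even i then A else B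
  have hKne : ∀ i, (K i).Nonempty := fun i => by simp only [K]; split_ifs <;> assumption
  have hK1 : ∀ i, (1 : ℝ) ≤ (K i).card := fun i => by exact_mod_cast (hKne i).card_pos
  have hK : ∀ i, ∀ v ∈ K i, ∀ w, G.Adj v w → w ∈ K (i + 1) := by
    intro i v hv w h
    by_cases hi : Even i
    · simp only [K, hi, if_true, Nat.even_add_one, not_true, if_false] at hv ⊢
      exact hAadj v hv w h
    · simp only [K, hi, if_false, Nat.even_add_one, not_false_eq_true, if_true] at hv ⊢
      exact hBadj v hv w h
  have hKdeg : ∀ i, ∀ v ∈ S, v ∈ K i →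
      e / (2 * ((K i).card : ℝ)) ≤ ((S.filter (G.Adj v)).card : ℝ) := by
    intro i v hv hvK
    have h := hSdeg v hv
    by_cases hi : Even i
    · simp only [K, hi, if_true] at hvK ⊢
      simpa only [hvK, if_true, hn] using h
    · simp only [K, hi, if_false] at hvK ⊢
      simpa only [Finset.disjoint_right.1 hdisj hvK, if_false, hm] using h
  obtain ⟨v₀, hv₀S, hv₀A⟩ : ∃ v ∈ S, v ∈ A := by
    obtain ⟨v, hv⟩ := hS
    by_cases hvA : v ∈ A
    · exact ⟨v, hv, hvA⟩
    · have hvB := (hmem v).resolve_left hvA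
      have h := hSdeg v hv
      simp only [hvA, if_false] at h
      -- The weights are positive, so a vertex of `S` in `B` has a neighbour in `S`, which lies in
      -- `A`.
      have hpos : (0 : ℝ) < ((S.filter (G.Adj v)).card : ℝ) := lt_of_lt_of_le (by positivity) h
      obtain ⟨w, hw⟩ := Finset.card_pos.1 (by exact_mod_cast hpos)
      obtain ⟨hwS, hvw⟩ := Finset.mem_filter.1 hw
      exact ⟨w, hwS, hBadj v hvB w hvw⟩
  have hKmax : ∀ i, ((K i).card : ℝ) ≤ max (m : ℝ) n := by
    intro i
    simp only [K]
    split_ifs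
    · rw [hn]; exact le_max_right _ _
    · rw [hm]; exact le_max_left _ _
  have hKmin : ∀ i, min (m : ℝ) n ≤ ((K i).card : ℝ) := by
    intro i
    simp only [K]
    split_ifs
    · rw [hn]; exact min_le_right _ _
    · rw [hm]; exact min_le_left _ _
  have hD0 : 0 ≤ D := le_trans (by positivity) hD2
  have hx : ∀ i, D ≤ e / (2 * ((K i).card : ℝ)) := by
    intro i
    have := hK1 i
    rw [le_div_iff₀ (by positivity)]
    have := mul_le_mul_of_nonneg_left (hKmax i) hD0
    linarith
  obtain ⟨k, rfl⟩ : ∃ k, s = k + 1 := ⟨s - 1, by omega⟩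
  have hmul : ((K k).card : ℝ) * (K (k + 1)).card = min (m : ℝ) n * max (m : ℝ) n := by
    rw [min_mul_max]
    by_cases hk : Even k
    · simp only [K, hk, if_true, Nat.even_add_one, not_true, if_false, hn, hm]
      ring
    · simp only [K, hk, if_true, Nat.even_add_one, not_false_eq_true, if_false, hn, hm]
  have hμ1 : (1 : ℝ) ≤ min (m : ℝ) n := le_min hm1 hn1
  -- Consecutive classes have sizes with product mn, so e/(2|K k|) = e|K (k+1)|/(2mn), which
  -- supplies the extra ratio.
  have hxk : D * (((K (k + 1)).card : ℝ) / min (m : ℝ) n) ≤ e / (2 * ((K k).card : ℝ)) := by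
    have := hK1 k
    rw [le_div_iff₀ (by positivity)]
    have hrw : D * (((K (k + 1)).card : ℝ) / min (m : ℝ) n) * (2 * ((K k).card : ℝ)) =
        2 * D * (((K k).card : ℝ) * (K (k + 1)).card) / min (m : ℝ) n := by ring
    rw [hrw, hmul, div_le_iff₀ (by linarith)]
    nlinarith
  push_cast at hD2
  have hprod := le_prod_range_sub (C := c * min (m : ℝ) n) hD2
    ((one_le_div (by linarith)).2 (hKmin (k + 1))) hDpow hx hxk
  obtain ⟨T, hT, hTcard⟩ := exists_finset_isTrail G S K _ hK hKdeg v₀ hv₀S (by simpa [K] using hv₀A)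
    (k + 1) (fun i hi => by
      have hi' : (i : ℝ) ≤ k := by exact_mod_cast Nat.lt_succ_iff.1 hi
      have hk0 : (0 : ℝ) ≤ k := Nat.cast_nonneg k
      nlinarith [hx i])
  have hfew := card_lt_of_avoids G (K (k + 1)) (hKne _) (k + 1) c v₀ (hG_avoids v₀ hv₀A) T
    fun p hp => ⟨(hT p hp).1, (hT p hp).2.1, (hT p hp).2.2.2⟩
  have hfew' : (T.card : ℝ) < c * (K (k + 1)).card := by exact_mod_cast hfew
  have heq : (c * min (m : ℝ) n) * (((K (k + 1)).card : ℝ) / min (m : ℝ) n) =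
      c * (K (k + 1)).card := by
    have : min (m : ℝ) n ≠ 0 := by linarith
    field_simp
  linarith
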